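/- Let $\Omega$ be a non-empty Polish space with Borel $\sigma$-algebra $\mathcal F$, let $d,T\ge 1$, and let $S=(S_t)_{t=0,\dots,T}$ be an $\mathbb R^d$-valued process of Borel measurable (discounted) prices on $\Omega$ with $S_0$ constant. Write $\mathcal F_t=\sigma(S_0,\dots,S_t)$ and $\Delta S_t=S_t-S_{t-1}$. Let $\mathcal M$ be the set of Borel probability measures on $\Omega$ under which $S$ is an $(\mathcal F_t)$-martingale, and $\mathcal M_+$ the set of those $Q\in\mathcal M$ whose support is $\Omega$. *Standard separators.* For $D\subseteq\mathbb R^d$ let $D^{cc}=\{r x: r>0,\ x\in \mathrm{conv}\,D\}\cup\{0\}$. For $K\subseteq\mathbb R^d$ let $V_K=\{v\in\mathbb R^d:\|v\|=1,\ v\cdot y\ge 0\ \forall y\in K\}$, fix once and for all an enumeration $(v^K_n)_{n\ge1}$ of a countable dense subset of $V_K$ (repetitions are allowed, and zeros may be used to fill up the sequence), and call $\sigma(K)=\sum_{n\ge 1}2^{-(n-1)}v_n^K$ the standard separator of $K$. *Decomposition.* For $1\le t\le T$ and $\Gamma\subseteq\Omega$ put $A^0=\Gamma$ and, for $i\ge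 1$, $H^i=\sigma\big((\Delta S_t(A^{i-1}))^{cc}\big)$, $B^i=\{\omega\in A^{i-1}: H^i\cdot\Delta S_t(\omega)>0\}$, $A^i=A^{i-1}\setminus B^i$. Let $\beta$ be the first $i\ge 0$ such that $0$ lies in the relative interior of $(\Delta S_t(A^i))^{cc}$, and put $H_{t,\Gamma}=\sum_{i=1}^{\beta}H^i\mathbf 1_{B^i}$. *Universal Arbitrage Aggregator and enlarged filtration.* For $\omega\in\Omega$ let $\Sigma_{t-1}(\omega)=\{\omega': S_s(\omega')=S_s(\omega)\ \forall s\le t-1\}$. Put $\Omega_T=\Omega$ and, for $t=T,\dots,1$, $\Omega_{t-1}=\Omega_t\setminus\{\omega: 0\notin\mathrm{conv}\,\Delta S_t(\Omega_t\cap\Sigma_{t-1}(\omega))\}$. Define $H^\bullet_t(\omega)=H_{t,\Gamma}(\omega)$ with $\Gamma=\Omega_t\cap\Sigma_{t-1}(\omega)$, and $\widetilde{\mathcal F}_t=\mathcal F_t\vee\sigma(H^\bullet_1,\dots,H^\bullet_{\min(t+1,T)})$ for $0\le t\le T$. Let $\widetilde{\mathcal H}$ be the set of all $H=(H_1,\dots,H_T)$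 such that $H_t:\Omega\to\mathbb R^d$ is $\widetilde{\mathcal F}_{t-1}$-measurable for every $t$, and put $V_T(H)=\sum_{t=1}^T H_t\cdot\Delta S_t$. *Arbitrage.* Let $\mathcal S$ be a class of Borel subsets of $\Omega$ with $\varnothing\notin\mathcal S$. An Arbitrage de la classe $\mathcal S$ in $\widetilde{\mathcal H}$ is an $H\in\widetilde{\mathcal H}$ such that $V_T(H)(\omega)\ge 0$ for all $\omega\in\Omega$ and $\{V_T(H)>0\}$ contains a set of $\mathcal S$. It is called an Open Arbitrage when $\mathcal S$ is the class of non-empty open subsets of $\Omega$. **Corollary.** (i) Suppose that there is a sequence $(C_n)_{n\in\mathbb N}$ in $\mathcal S$ such that every $C\in\mathcal S$ contains some $C_n$. Then there is no Arbitrage de la classe $\mathcal S$ in $\widetilde{\mathcal H}$ if and only if there is $Q\in\mathcal M$ with $Q(C)>0$ for all $C\in\mathcal S$. (ii) The class of non-empty open subsets of $\Omega$ satisfies the hypothesis of (i), and there is no Open Arbitrage in $\widetilde{\mathcal H}$ if and only if $\mathcal M_+\neq\varnothing$. -/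

import Mathlib

open MeasureTheory Set

noncomputable section

namespace ArbitrageClass

/-- The space of (vectors of) asset prices, with the Euclidean inner product. -/
abbrev Prices (d : ℕ) : Type := EuclideanSpace ℝ (Fin d)

/-! ### Convex cones and standard separators -/

/-- The convex cone `D^cc = co (conv D) ∪ {0}` generated by a set `D` of vectors. -/
def coneHull {d : ℕ} (D : Set (Prices d)) : Set (Prices d) :=
  {y | ∃ r : ℝ, 0 < r ∧ ∃ x ∈ convexHull ℝ D, y = r • x} ∪ {0}

/-- The unit vectors `v` with `v · y ≥ 0` for all `y ∈ K`. -/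
def unitSeparators {d : ℕ} (K : Set (Prices d)) : Set (Prices d) :=
  {v | ‖v‖ = 1 ∧ ∀ y ∈ K, 0 ≤ inner ℝ v y}

/-- `v` lists, for every set `K`, a countable dense family of unit separators of `K`; a finite
family may be listed by filling the sequence up with zeros. -/
def IsSeparatorEnumeration {d : ℕ} (v : Set (Prices d) → ℕ → Prices d) : Prop :=
  ∀ K : Set (Prices d),
    (∀ n, v K n ∈ unitSeparators K ∨ v K n = 0) ∧ unitSeparators K ⊆ closure (range (v K))

theorem exists_isSeparatorEnumeration (d : ℕ) :
    ∃ v : Set (Prices d) → ℕ → Prices d, IsSeparatorEnumeration v := by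
  have h : ∀ K : Set (Prices d), ∃ w : ℕ → Prices d,
      (∀ n, w n ∈ unitSeparators K ∨ w n = 0) ∧ unitSeparators K ⊆ closure (range w) := by
    intro K
    rcases (unitSeparators K).eq_empty_or_nonempty with hK | hK
    · exact ⟨fun _ => 0, fun _ => Or.inr rfl, by simp [hK]⟩
    · have : Nonempty (unitSeparators K) := hK.to_subtype
      refine ⟨fun n => (TopologicalSpace.denseSeq (unitSeparators K) n : Prices d),
        fun n => Or.inl (Subtype.prop _), fun x hx => ?_⟩
      have hd := (TopologicalSpace.denseRange_denseSeq (unitSeparators K)) ⟨x, hx⟩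
      have := image_closure_subset_closure_image continuous_subtype_val (mem_image_of_mem _ hd)
      rwa [← range_comp] at this
  choose v hv using h
  exact ⟨v, hv⟩

/-- The standard separator `∑_{n ≥ 1} 2^{-(n-1)} v_n` of `K` (the sequence is indexed from `0`). -/
def standardSeparator {d : ℕ} (v : Set (Prices d) → ℕ → Prices d) (K : Set (Prices d)) :
    Prices d :=
  ∑' n : ℕ, (1 / 2 : ℝ) ^ n • v K n

/-! ### The decomposition of a set of events along an increment `X` of the prices -/

section Decomposition

variable {Ω : Type*} {d : ℕ}

/-- The sets `A^0 = Γ`, `A^{i+1} = A^i \ B^{i+1}`, where `B^{i+1}` is the part of `A^i` on which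
the standard separator of the cone generated by `X (A^i)` yields a strictly positive gain. -/
def remainder (v : Set (Prices d) → ℕ → Prices d) (X : Ω → Prices d) (Γ : Set Ω) : ℕ → Set Ω
  | 0 => Γ
  | i + 1 => {ω ∈ remainder v X Γ i |
      ¬ 0 < inner ℝ (standardSeparator v (coneHull (X '' remainder v X Γ i))) (X ω)}

/-- The strategy of step `i` (`H^{i+1}` when steps are counted from `1`). -/
def layerStrategy (v : Set (Prices d) → ℕ → Prices d) (X : Ω → Prices d) (Γ : Set Ω) (i : ℕ) :
    Prices d :=
  standardSeparator v (coneHull (X '' remainder v X Γ i))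

/-- The layer of step `i` (`B^{i+1}` when steps are counted from `1`). -/
def layer (v : Set (Prices d) → ℕ → Prices d) (X : Ω → Prices d) (Γ : Set Ω) (i : ℕ) : Set Ω :=
  {ω ∈ remainder v X Γ i | 0 < inner ℝ (layerStrategy v X Γ i) (X ω)}

/-- The number `β` of steps: the first `i` for which `0` lies in the relative interior of the
convex cone generated by `X (A^i)`. -/
def depth (v : Set (Prices d) → ℕ → Prices d) (X : Ω → Prices d) (Γ : Set Ω) : ℕ :=
  sInf {i : ℕ | (0 : Prices d) ∈ intrinsicInterior ℝ (coneHull (X '' remainder v X Γ i))}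

/-- The random vector `∑_{i = 1}^{β} H^i 1_{B^i}`. -/
def layeredStrategy (v : Set (Prices d) → ℕ → Prices d) (X : Ω → Prices d) (Γ : Set Ω) (ω : Ω) :
    Prices d :=
  ∑ i ∈ Finset.range (depth v X Γ), (layer v X Γ i).indicator (fun _ => layerStrategy v X Γ i) ω

end Decomposition

/-! ### The market -/

/-- A market with `d` risky assets and dates `0, …, T`: the discounted prices are random vectors,
and the initial ones are deterministic (the initial sigma-algebra is trivial). -/
structure Market (Ω : Type*) [MeasurableSpace Ω] (d T : ℕ) where
  /-- The price process. -/
  price : Fin (T + 1) → Ω → Prices d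
  measurable_price : ∀ t, Measurable (price t)
  price_zero : ∀ ω ω', price 0 ω = price 0 ω'

namespace Market

variable {Ω : Type*} [MeasurableSpace Ω] {d T : ℕ} (𝓜 : Market Ω d T)

/-- The natural filtration of the price process. -/
def filtration : Filtration (Fin (T + 1)) ‹MeasurableSpace Ω› :=
  Filtration.natural 𝓜.price fun t => (𝓜.measurable_price t).stronglyMeasurable

/-- The price increment of the trading period `t : Fin T`, which runs from the date `t` to the
date `t + 1`. -/
def increment (t : Fin T) (ω : Ω) : Prices d :=
  𝓜.price t.succ ω - 𝓜.price t.castSucc ω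

/-- The level set of the prices up to the date `t` that contains `ω`. -/
def levelSet (t : Fin (T + 1)) (ω : Ω) : Set Ω :=
  {ω' | ∀ s ≤ t, 𝓜.price s ω' = 𝓜.price s ω}

/-- The sets `Ω_t`, by backward recursion from `Ω_T = Ω`: a level set of the prices up to the
date `t` is removed when `0` is not in the convex hull of the next increments on what is left of
it in `Ω_{t+1}`. -/
def survivors : Fin (T + 1) → Set Ω :=
  Fin.reverseInduction (motive := fun _ => Set Ω) univ fun t Ω' =>
    Ω' \ {ω | (0 : Prices d) ∉
      convexHull ℝ (𝓜.increment t '' (Ω' ∩ 𝓜.levelSet t.castSucc ω))}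

/-- The Universal Arbitrage Aggregator: in each trading period, and on each level set of the
prices so far, it is the layered strategy of the part of that level set in `Ω_{t+1}`. -/
def aggregator (v : Set (Prices d) → ℕ → Prices d) (t : Fin T) (ω : Ω) : Prices d :=
  layeredStrategy v (𝓜.increment t)
    (𝓜.survivors t.succ ∩ 𝓜.levelSet t.castSucc ω) ω

/-- The enlarged filtration: at the date `t`, the natural filtration together with the positions
of the aggregator in all trading periods that start at or before `t`. Its members need not consist
of Borel sets. -/
@[reducible] def enlargedFiltration (v : Set (Prices d) → ℕ → Prices d) (t : Fin (T + 1)) :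
    MeasurableSpace Ω :=
  𝓜.filtration t ⊔
    ⨆ s : Fin T, ⨆ _ : s.castSucc ≤ t, MeasurableSpace.comap (𝓜.aggregator v s) inferInstance

/-- The class of trading strategies that are predictable for the enlarged filtration. -/
def enlargedStrategies (v : Set (Prices d) → ℕ → Prices d) : Set (Fin T → Ω → Prices d) :=
  {H | ∀ t : Fin T, Measurable[𝓜.enlargedFiltration v t.castSucc] (H t)}

/-- The final value of a self-financing strategy with zero initial cost. -/
def finalValue (H : Fin T → Ω → Prices d) (ω : Ω) : ℝ :=
  ∑ t : Fin T, inner ℝ (H t ω) (𝓜.increment t ω)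

/-- The strategy `H` is an Arbitrage de la classe `𝒮`. -/
def IsArbitrage (𝒮 : Set (Set Ω)) (H : Fin T → Ω → Prices d) : Prop :=
  (∀ ω, 0 ≤ 𝓜.finalValue H ω) ∧ ∃ C ∈ 𝒮, C ⊆ {ω | 0 < 𝓜.finalValue H ω}

/-- No Arbitrage de la classe `𝒮` among the strategies predictable for the enlarged filtration. -/
def NoArbitrage (v : Set (Prices d) → ℕ → Prices d) (𝒮 : Set (Set Ω)) : Prop :=
  ¬ ∃ H ∈ 𝓜.enlargedStrategies v, 𝓜.IsArbitrage 𝒮 H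

/-- The martingale measures, with respect to the natural filtration. -/
def martingaleMeasures : Set (ProbabilityMeasure Ω) :=
  {Q | Martingale 𝓜.price 𝓜.filtration (Q : Measure Ω)}

end Market

/-! ### Classes of significant sets -/

/-- The probability measures that charge every set of the class `𝒮`. -/
def chargingMeasures {Ω : Type*} [MeasurableSpace Ω] (𝒮 : Set (Set Ω)) :
    Set (ProbabilityMeasure Ω) :=
  {Q | ∀ C ∈ 𝒮, 0 < (Q : Measure Ω) C}

/-- The probability measures with full support. -/
def fullSupportMeasures (Ω : Type*) [TopologicalSpace Ω] [MeasurableSpace Ω] :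
    Set (ProbabilityMeasure Ω) :=
  {Q | (Q : Measure Ω).support = univ}

/-- The class `𝒮` contains a sequence of sets such that each set of `𝒮` contains one of them. -/
def HasCountableCore {Ω : Type*} (𝒮 : Set (Set Ω)) : Prop :=
  ∃ C : ℕ → Set Ω, (∀ n, C n ∈ 𝒮) ∧ ∀ D ∈ 𝒮, ∃ n, C n ⊆ D

/-- The class of non-empty open sets, which defines Open Arbitrage. -/
def nonemptyOpens (Ω : Type*) [TopologicalSpace Ω] : Set (Set Ω) :=
  {C | IsOpen C ∧ C.Nonempty}

end ArbitrageClass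

end

/-! The link between the pointwise and the probabilistic side is the aggregator, whose gain is
nonnegative in every period and at every point.

Without arbitrage the aggregator is not one either, so each `C n` contains some `ω` at which all its
gains vanish. In every period `ω` then lies in the last remainder of the decomposition, where 0 is
relatively interior to the cone of increments, so the increment at `ω` is balanced by surviving
ones. Gluing backwards in time gives a martingale measure with an atom at `ω`
(`exists_isMartingaleFrom_charging`), and a countable mixture of these charges every `C n`.

Conversely, under a martingale measure the conditional increments have mean zero, so separators gain
nothing, no point is removed, and the aggregator vanishes almost everywhere
(`ae_mem_survivors_step`). The enlargement thus adds only generators that are null or conull, its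
strategies agree a.e. with strategies predictable for the natural filtration, and for these a
nonnegative final value is a.e. zero (`finalValue_ae_eq_zero`). The survivor sets and the level sets
of the aggregator need not be Borel, so they enter through almost-everywhere statements only. -/

noncomputable section

namespace ArbitrageClass

/-! ### Relative interiors of cones and separation from 0 -/

section Cones

variable {d : ℕ}

theorem zero_mem_coneHull (D : Set (Prices d)) : (0 : Prices d) ∈ coneHull D :=
  Or.inr rfl

theorem subset_coneHull (D : Set (Prices d)) : D ⊆ coneHull D := fun x hx =>
  Or.inl ⟨1, one_pos, x, subset_convexHull ℝ D hx, (one_smul ℝ x).symm⟩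

theorem coneHull_eq_union_hull (D : Set (Prices d)) :
    coneHull D = (ConvexCone.hull ℝ (convexHull ℝ D) : Set (Prices d)) ∪ {0} := by
  ext y
  refine or_congr ?_ Iff.rfl
  rw [SetLike.mem_coe, ConvexCone.mem_hull_of_convex (convex_convexHull ℝ D)]
  simp only [mem_smul_set, eq_comm]
  rfl

theorem smul_mem_coneHull {D : Set (Prices d)} {y : Prices d} (hy : y ∈ coneHull D) {a : ℝ}
    (ha : 0 ≤ a) : a • y ∈ coneHull D := by
  rcases ha.eq_or_lt with rfl | ha
  · simpa using zero_mem_coneHull D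
  rcases hy with ⟨r, hr, x, hx, rfl⟩ | hy
  · exact Or.inl ⟨a * r, mul_pos ha hr, x, hx, smul_smul _ _ _⟩
  · rw [mem_singleton_iff.1 hy, smul_zero]
    exact zero_mem_coneHull D

theorem convex_coneHull (D : Set (Prices d)) : Convex ℝ (coneHull D) := by
  have hadd : ∀ y ∈ coneHull D, ∀ z ∈ coneHull D, y + z ∈ coneHull D := by
    intro y hy z hz
    rw [coneHull_eq_union_hull] at hy hz ⊢
    rcases hy with hy | hy <;> rcases hz with hz | hz
    · exact Or.inl (ConvexCone.add_mem _ hy hz)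
    · rw [mem_singleton_iff.1 hz, add_zero]; exact Or.inl hy
    · rw [mem_singleton_iff.1 hy, zero_add]; exact Or.inl hz
    · rw [mem_singleton_iff.1 hy, zero_add]; exact Or.inr hz
  intro y hy z hz a b ha hb _
  exact hadd _ (smul_mem_coneHull hy ha) _ (smul_mem_coneHull hz hb)

theorem affineSpan_eq_span_of_zero_mem {K : Set (Prices d)} (h0 : (0 : Prices d) ∈ K) :
    (affineSpan ℝ K : Set (Prices d)) = Submodule.span ℝ K := by
  have := affineSpan_insert_zero (k := ℝ) (s := K)
  rwa [insert_eq_of_mem h0] at this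

/-- The affine span of a set containing 0 is its linear span. -/
theorem zero_mem_intrinsicInterior_iff {K : Set (Prices d)} (h0 : (0 : Prices d) ∈ K) :
    (0 : Prices d) ∈ intrinsicInterior ℝ K ↔
      ∃ ε > 0, Metric.ball (0 : Prices d) ε ∩ Submodule.span ℝ K ⊆ K := by
  have hs := affineSpan_eq_span_of_zero_mem h0
  have hmem : (0 : Prices d) ∈ affineSpan ℝ K := subset_affineSpan ℝ K h0
  have : (0 : Prices d) ∈ intrinsicInterior ℝ K ↔
      ((↑) ⁻¹' K : Set (affineSpan ℝ K)) ∈ nhds (⟨0, hmem⟩ : affineSpan ℝ K) := by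
    rw [mem_intrinsicInterior, ← mem_interior_iff_mem_nhds]
    constructor
    · rintro ⟨y, hy, h⟩
      rwa [show (⟨0, hmem⟩ : affineSpan ℝ K) = y from Subtype.ext h.symm]
    · exact fun h => ⟨_, h, rfl⟩
  rw [this, Metric.mem_nhds_iff, ← hs]
  constructor
  · rintro ⟨ε, hε, h⟩
    exact ⟨ε, hε, fun y hy => h (a := ⟨y, hy.2⟩) hy.1⟩
  · rintro ⟨ε, hε, h⟩
    exact ⟨ε, hε, fun y hy => h ⟨hy, y.2⟩⟩

/-- A small multiple of `-y` stays in the cone. This balancing is what later lets a martingale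
measure charge a prescribed increment. -/
theorem exists_add_smul_eq_zero {D : Set (Prices d)}
    (h : (0 : Prices d) ∈ intrinsicInterior ℝ (coneHull D)) {y : Prices d} (hy : y ∈ D) :
    ∃ c : ℝ, 0 ≤ c ∧ ∃ x ∈ convexHull ℝ D, y + c • x = 0 := by
  obtain ⟨ε, hε, hb⟩ := (zero_mem_intrinsicInterior_iff (zero_mem_coneHull D)).1 h
  have hn : 0 < ‖y‖ + 1 := by positivity
  set a : ℝ := ε / (‖y‖ + 1) with ha
  have ha0 : 0 < a := by positivity
  have hm : -(a • y) ∈ coneHull D := by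
    refine hb ⟨?_, ?_⟩
    · rw [mem_ball_zero_iff, norm_neg, norm_smul, Real.norm_of_nonneg ha0.le, ha, div_mul_eq_mul_div,
        div_lt_iff₀ hn]
      nlinarith
    · exact Submodule.neg_mem _ (Submodule.smul_mem _ _
        (Submodule.subset_span (subset_coneHull D hy)))
  rcases hm with ⟨r, hr, x, hx, hrx⟩ | hm
  · refine ⟨a⁻¹ * r, by positivity, x, hx, ?_⟩
    rw [mul_smul, ← hrx, smul_neg, smul_smul, inv_mul_cancel₀ ha0.ne', one_smul, add_neg_cancel]
  -- Here `-(a • y)` is the apex, so `y = 0` and no balancing is needed.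
  · refine ⟨0, le_rfl, y, subset_convexHull ℝ D hy, ?_⟩
    rw [mem_singleton_iff, neg_eq_zero, smul_eq_zero, or_iff_right ha0.ne'] at hm
    simp [hm]

theorem zero_mem_convexHull {D : Set (Prices d)}
    (h : (0 : Prices d) ∈ intrinsicInterior ℝ (coneHull D)) (hD : D.Nonempty) :
    (0 : Prices d) ∈ convexHull ℝ D := by
  obtain ⟨y, hy⟩ := hD
  obtain ⟨c, hc, x, hx, hyx⟩ := exists_add_smul_eq_zero h hy
  have h1 : 0 < 1 + c := by positivity
  have := convex_convexHull ℝ D (subset_convexHull ℝ D hy) hx (a := 1 / (1 + c)) (b := c / (1 + c))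
    (by positivity) (by positivity) (by field_simp)
  have h2 : (1 / (1 + c)) • y + (c / (1 + c)) • x = (1 / (1 + c)) • (y + c • x) := by
    rw [smul_add, smul_smul]; congr 2; ring
  rwa [h2, hyx, smul_zero] at this

/-- Inside its linear span the cone has nonempty interior, which Hahn–Banach separates strictly from
0. Working in the span rules out separators orthogonal to all of `D`. -/
theorem exists_unitSeparator_pos {D : Set (Prices d)}
    (h : (0 : Prices d) ∉ intrinsicInterior ℝ (coneHull D)) :
    ∃ v ∈ unitSeparators (coneHull D), ∃ y ∈ D, 0 < inner ℝ v y := by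
  set K := coneHull D with hK
  have h0 : (0 : Prices d) ∈ K := zero_mem_coneHull D
  set L := Submodule.span ℝ K with hL
  set KL : Set L := (↑) ⁻¹' K with hKL
  have hconv : Convex ℝ KL := (convex_coneHull D).linear_preimage L.subtype
  have h0L : (0 : L) ∈ KL := h0
  have hspan : affineSpan ℝ KL = ⊤ := by
    rw [← AffineSubspace.coe_eq_univ_iff]
    have : (affineSpan ℝ KL : Set L) = Submodule.span ℝ KL := by
      have := affineSpan_insert_zero (k := ℝ) (s := KL)
      rwa [insert_eq_of_mem h0L] at this
    rw [this, hKL, hL, Submodule.span_span_coe_preimage]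
    rfl
  have hint : (interior KL).Nonempty := hconv.interior_nonempty_iff_affineSpan_eq_top.2 hspan
  have hnot : (0 : L) ∉ interior KL := by
    intro hmem
    rw [mem_interior_iff_mem_nhds, Metric.mem_nhds_iff] at hmem
    obtain ⟨ε, hε, hb⟩ := hmem
    exact h ((zero_mem_intrinsicInterior_iff h0).2
      ⟨ε, hε, fun y hy => hb (a := (⟨y, hy.2⟩ : L)) (by simpa using hy.1)⟩)
  obtain ⟨f, hf⟩ := geometric_hahn_banach_open_point hconv.interior isOpen_interior hnot
  rw [map_zero] at hf
  have hfK : ∀ y ∈ KL, f y ≤ 0 := by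
    have h1 : closure (interior KL) ⊆ {y | f y ≤ 0} :=
      closure_minimal (fun y hy => (hf y hy).le) (isClosed_le f.continuous continuous_const)
    rw [hconv.closure_interior_eq_closure_of_nonempty_interior hint] at h1
    exact fun y hy => h1 (subset_closure hy)
  set w : L := -(InnerProductSpace.toDual ℝ L).symm f with hw
  have hwf : ∀ y : L, inner ℝ (w : Prices d) (y : Prices d) = -f y := by
    intro y
    rw [← Submodule.coe_inner, hw, inner_neg_left, InnerProductSpace.toDual_symm_apply]
  obtain ⟨y0, hy0⟩ := hint
  have hwn : 0 < ‖(w : Prices d)‖ := by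
    rw [norm_pos_iff]
    intro hw0
    have := hwf y0
    rw [hw0, inner_zero_left] at this
    linarith [hf y0 hy0]
  refine ⟨‖(w : Prices d)‖⁻¹ • (w : Prices d), ⟨?_, fun y hy => ?_⟩, ?_⟩
  · rw [norm_smul, norm_inv, norm_norm, inv_mul_cancel₀ hwn.ne']
  · rw [real_inner_smul_left]
    have := hwf ⟨y, Submodule.subset_span hy⟩
    have h2 := hfK ⟨y, Submodule.subset_span hy⟩ hy
    simp only at this
    rw [this]
    exact mul_nonneg (inv_nonneg.2 hwn.le) (by linarith)
  -- A functional nonpositive on `D` is nonpositive on the cone, hence at the interior point `y0`,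
  -- where separation is strict.
  · by_contra! hcon
    have hD : ∀ y ∈ D, inner ℝ (w : Prices d) y ≤ 0 := by
      intro y hy
      have := hcon y hy
      rw [real_inner_smul_left] at this
      exact nonpos_of_mul_nonpos_right this (inv_pos.2 hwn)
    have hcD : convexHull ℝ D ⊆ {y | inner ℝ (w : Prices d) y ≤ 0} :=
      convexHull_min hD (convex_halfSpace_le (innerₛₗ ℝ (w : Prices d)).isLinear 0)
    have hpos : 0 < inner ℝ (w : Prices d) (y0 : Prices d) := by
      rw [hwf]; linarith [hf y0 hy0]
    have hyK : y0 ∈ KL := interior_subset hy0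
    rcases hyK with ⟨r, hr, x, hx, hrx⟩ | hyK
    · rw [hrx, real_inner_smul_right] at hpos
      exact absurd (hcD hx) (not_le.2 (pos_of_mul_pos_right hpos hr.le))
    · rw [mem_singleton_iff.1 hyK, inner_zero_right] at hpos
      exact lt_irrefl _ hpos

end Cones

/-! ### Positivity of the standard separator -/

section Separators

variable {d : ℕ} {v : Set (Prices d) → ℕ → Prices d}

theorem IsSeparatorEnumeration.norm_le_one (hv : IsSeparatorEnumeration v) (K : Set (Prices d))
    (n : ℕ) : ‖v K n‖ ≤ 1 := by
  rcases (hv K).1 n with h | h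
  · exact h.1.le
  · simp [h]

theorem IsSeparatorEnumeration.inner_nonneg (hv : IsSeparatorEnumeration v) {K : Set (Prices d)}
    (n : ℕ) {y : Prices d} (hy : y ∈ K) : 0 ≤ inner ℝ (v K n) y := by
  rcases (hv K).1 n with h | h
  · exact h.2 y hy
  · simp [h]

theorem IsSeparatorEnumeration.hasSum_standardSeparator (hv : IsSeparatorEnumeration v)
    (K : Set (Prices d)) (y : Prices d) :
    HasSum (fun n : ℕ => (1 / 2 : ℝ) ^ n * inner ℝ (v K n) y)
      (inner ℝ (standardSeparator v K) y) := by
  have hs : Summable fun n : ℕ => (1 / 2 : ℝ) ^ n • v K n := by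
    refine Summable.of_norm_bounded summable_geometric_two fun n => ?_
    rw [norm_smul, norm_pow, Real.norm_of_nonneg (by norm_num : (0 : ℝ) ≤ 1 / 2)]
    exact mul_le_of_le_one_right (by positivity) (hv.norm_le_one K n)
  have := hs.hasSum.mapL (innerSL ℝ y)
  simpa only [innerSL_apply_apply, real_inner_smul_right, real_inner_comm, standardSeparator]
    using this

theorem IsSeparatorEnumeration.standardSeparator_nonneg (hv : IsSeparatorEnumeration v)
    {K : Set (Prices d)} {y : Prices d} (hy : y ∈ K) :
    0 ≤ inner ℝ (standardSeparator v K) y :=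
  (hv.hasSum_standardSeparator K y).nonneg fun n =>
    mul_nonneg (by positivity) (hv.inner_nonneg n hy)

/-- By density some `v K n` is already positive at `y`, and no other term of the series is negative.
-/
theorem IsSeparatorEnumeration.standardSeparator_pos (hv : IsSeparatorEnumeration v)
    {K : Set (Prices d)} {y u : Prices d} (hy : y ∈ K) (hu : u ∈ unitSeparators K)
    (huy : 0 < inner ℝ u y) : 0 < inner ℝ (standardSeparator v K) y := by
  have hopen : IsOpen {w : Prices d | 0 < inner ℝ w y} :=
    isOpen_lt continuous_const (by fun_prop)
  obtain ⟨w, hw, n, rfl⟩ := mem_closure_iff.1 ((hv K).2 hu) _ hopen huy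
  have hs := hv.hasSum_standardSeparator K y
  rw [← hs.tsum_eq]
  exact hs.summable.tsum_pos (fun m => mul_nonneg (by positivity) (hv.inner_nonneg m hy)) n
    (mul_pos (by positivity) hw)

end Separators

/-! ### Termination of the decomposition and its gains -/

section Layers

variable {Ω : Type*} {d : ℕ} {v : Set (Prices d) → ℕ → Prices d} {X : Ω → Prices d} {Γ : Set Ω}

theorem remainder_succ_subset (i : ℕ) : remainder v X Γ (i + 1) ⊆ remainder v X Γ i :=
  fun _ h => h.1

theorem remainder_antitone : Antitone (remainder v X Γ) :=
  antitone_nat_of_succ_le remainder_succ_subset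

theorem remainder_subset (i : ℕ) : remainder v X Γ i ⊆ Γ :=
  remainder_antitone (Nat.zero_le i)

theorem IsSeparatorEnumeration.layerStrategy_nonneg (hv : IsSeparatorEnumeration v) {i : ℕ} {ω : Ω}
    (h : ω ∈ remainder v X Γ i) : 0 ≤ inner ℝ (layerStrategy v X Γ i) (X ω) :=
  hv.standardSeparator_nonneg (subset_coneHull _ (mem_image_of_mem X h))

theorem IsSeparatorEnumeration.layerStrategy_eq_zero (hv : IsSeparatorEnumeration v) {i : ℕ} {ω : Ω}
    (h : ω ∈ remainder v X Γ (i + 1)) : inner ℝ (layerStrategy v X Γ i) (X ω) = 0 :=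
  le_antisymm (not_lt.1 h.2) (hv.layerStrategy_nonneg h.1)

/-- While 0 is not relatively interior, the separator is positive at some increment and orthogonal
to all that remain, so the dimension of their span drops. -/
theorem IsSeparatorEnumeration.zero_mem_intrinsicInterior_depth (hv : IsSeparatorEnumeration v)
    (X : Ω → Prices d) (Γ : Set Ω) :
    (0 : Prices d) ∈ intrinsicInterior ℝ (coneHull (X '' remainder v X Γ (depth v X Γ))) := by
  -- Since `sInf ∅ = 0` in `ℕ`, the set defining `depth` must be shown nonempty.
  refine Nat.sInf_mem (s := {i : ℕ | (0 : Prices d) ∈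
    intrinsicInterior ℝ (coneHull (X '' remainder v X Γ i))}) ?_
  by_contra hne
  rw [not_nonempty_iff_eq_empty, eq_empty_iff_forall_notMem] at hne
  have hdec : ∀ i, Module.finrank ℝ (Submodule.span ℝ (X '' remainder v X Γ (i + 1))) <
      Module.finrank ℝ (Submodule.span ℝ (X '' remainder v X Γ i)) := by
    intro i
    obtain ⟨u, hu, y, hy, huy⟩ := exists_unitSeparator_pos (hne i)
    have hpos : 0 < inner ℝ (layerStrategy v X Γ i) y :=
      hv.standardSeparator_pos (subset_coneHull _ hy) hu huy
    refine Submodule.finrank_lt_finrank_of_lt (lt_of_le_of_ne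
      (Submodule.span_mono (image_mono (remainder_succ_subset i))) fun heq => ?_)
    have hy' : y ∈ Submodule.span ℝ (X '' remainder v X Γ (i + 1)) := by
      rw [heq]; exact Submodule.subset_span hy
    have hle : Submodule.span ℝ (X '' remainder v X Γ (i + 1)) ≤
        LinearMap.ker (innerₛₗ ℝ (layerStrategy v X Γ i)) := by
      rw [Submodule.span_le]
      rintro _ ⟨ω, hω, rfl⟩
      exact hv.layerStrategy_eq_zero hω
    exact hpos.ne' (hle hy')
  exact not_strictAnti_of_wellFoundedLT
    (fun i => Module.finrank ℝ (Submodule.span ℝ (X '' remainder v X Γ i)))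
    (strictAnti_nat_of_succ_lt hdec)

theorem inner_layer_indicator_nonneg (i : ℕ) (ω : Ω) :
    0 ≤ inner ℝ ((layer v X Γ i).indicator (fun _ => layerStrategy v X Γ i) ω) (X ω) := by
  by_cases h : ω ∈ layer v X Γ i
  · rw [indicator_of_mem h]; exact h.2.le
  · rw [indicator_of_notMem h, inner_zero_left]

theorem inner_layeredStrategy_nonneg (ω : Ω) : 0 ≤ inner ℝ (layeredStrategy v X Γ ω) (X ω) := by
  rw [layeredStrategy, sum_inner]
  exact Finset.sum_nonneg fun i _ => inner_layer_indicator_nonneg i ω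

/-- Leaving earlier would add a positive term to a sum of nonnegative ones. -/
theorem mem_remainder_of_inner_layeredStrategy_eq_zero {ω : Ω} (hω : ω ∈ Γ)
    (h : inner ℝ (layeredStrategy v X Γ ω) (X ω) = 0) : ω ∈ remainder v X Γ (depth v X Γ) := by
  rw [layeredStrategy, sum_inner, Finset.sum_eq_zero_iff_of_nonneg
    fun i _ => inner_layer_indicator_nonneg i ω] at h
  have : ∀ i ≤ depth v X Γ, ω ∈ remainder v X Γ i := by
    intro i
    induction i with
    | zero => exact fun _ => hω
    | succ i ih =>
      intro hi
      have hm := ih (by omega)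
      refine ⟨hm, fun hpos => ?_⟩
      have h0 := h i (Finset.mem_range.2 (by omega))
      have hl : ω ∈ layer v X Γ i := ⟨hm, hpos⟩
      rw [indicator_of_mem hl] at h0
      exact hl.2.ne' h0
  exact this _ le_rfl

theorem layeredStrategy_eq_zero_of_forall_mem {ω : Ω} (h : ∀ i, ω ∈ remainder v X Γ i) :
    layeredStrategy v X Γ ω = 0 :=
  Finset.sum_eq_zero fun i _ => indicator_of_notMem (fun hl => (h (i + 1)).2 hl.2) _

end Layers

/-! ### Level sets of prices and the survivor recursion -/

namespace Market

variable {Ω : Type*} [MeasurableSpace Ω] {d T : ℕ} {𝓜 : Market Ω d T}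

section LevelSets

theorem mem_levelSet_self (t : Fin (T + 1)) (ω : Ω) : ω ∈ 𝓜.levelSet t ω :=
  fun _ _ => rfl

theorem levelSet_eq_of_mem {t : Fin (T + 1)} {ω ω' : Ω} (h : ω' ∈ 𝓜.levelSet t ω) :
    𝓜.levelSet t ω' = 𝓜.levelSet t ω := by
  ext x
  exact forall₂_congr fun s hs => by rw [h s hs]

theorem levelSet_antitone (ω : Ω) : Antitone fun t => 𝓜.levelSet t ω :=
  fun _ _ hst _ h s hs => h s (hs.trans hst)

theorem increment_eq_of_mem_levelSet {t : Fin T} {ω ω' : Ω} (h : ω' ∈ 𝓜.levelSet t.succ ω) :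
    𝓜.increment t ω' = 𝓜.increment t ω := by
  rw [increment, increment, h _ le_rfl, h _ (Fin.castSucc_lt_succ).le]

theorem measurable_increment (t : Fin T) : Measurable (𝓜.increment t) :=
  (𝓜.measurable_price _).sub (𝓜.measurable_price _)

theorem filtration_eq_comap (t : Fin (T + 1)) :
    𝓜.filtration t = MeasurableSpace.comap (fun ω (s : Iic t) => 𝓜.price s ω) inferInstance :=
  Filtration.natural_eq_comap _ _ _

theorem stronglyMeasurable_price (t : Fin (T + 1)) :
    StronglyMeasurable[𝓜.filtration t] (𝓜.price t) :=
  Filtration.stronglyAdapted_natural (fun t => (𝓜.measurable_price t).stronglyMeasurable) t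

theorem measurable_price_filtration {s t : Fin (T + 1)} (hst : s ≤ t) :
    Measurable[𝓜.filtration t] (𝓜.price s) :=
  ((stronglyMeasurable_price s).mono (𝓜.filtration.mono hst)).measurable

theorem mem_iff_of_mem_levelSet {t : Fin (T + 1)} {A : Set Ω}
    (hA : MeasurableSet[𝓜.filtration t] A) {ω ω' : Ω} (h : ω' ∈ 𝓜.levelSet t ω) :
    ω' ∈ A ↔ ω ∈ A := by
  rw [filtration_eq_comap] at hA
  obtain ⟨B, -, rfl⟩ := hA
  have : (fun s : Iic t => 𝓜.price s ω') = fun s : Iic t => 𝓜.price s ω :=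
    funext fun s => h s s.2
  rw [mem_preimage, mem_preimage, this]

theorem survivors_last : 𝓜.survivors (Fin.last T) = univ := by
  simp [survivors]

theorem mem_survivors_castSucc {t : Fin T} {ω : Ω} :
    ω ∈ 𝓜.survivors t.castSucc ↔ ω ∈ 𝓜.survivors t.succ ∧
      (0 : Prices d) ∈ convexHull ℝ
        (𝓜.increment t '' (𝓜.survivors t.succ ∩ 𝓜.levelSet t.castSucc ω)) := by
  simp [survivors]

end LevelSets

/-! ### Martingale measures glued backwards from Dirac masses -/

section TreeMeasures

/-- A probability measure concentrated on `C` under which the prices are integrable and have the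
martingale property in all trading periods from the date `t` on. -/
structure IsMartingaleFrom (𝓜 : Market Ω d T) (t : Fin (T + 1)) (C : Set Ω) (μ : Measure Ω) :
    Prop where
  isProbabilityMeasure : IsProbabilityMeasure μ
  ae_mem : ∀ᵐ ω ∂μ, ω ∈ C
  integrable : ∀ s, Integrable (𝓜.price s) μ
  setIntegral_eq_zero : ∀ s : Fin T, t ≤ s.castSucc → ∀ A, MeasurableSet[𝓜.filtration s.castSucc] A →
    ∫ ω in A, 𝓜.increment s ω ∂μ = 0

variable {t : Fin (T + 1)} {C D : Set Ω} {μ ν : Measure Ω}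

theorem IsMartingaleFrom.integrable_increment (h : 𝓜.IsMartingaleFrom t C μ) (s : Fin T) :
    Integrable (𝓜.increment s) μ :=
  (h.integrable _).sub (h.integrable _)

theorem IsMartingaleFrom.mono (h : 𝓜.IsMartingaleFrom t C μ) (hCD : C ⊆ D) :
    𝓜.IsMartingaleFrom t D μ :=
  ⟨h.1, h.2.mono fun _ hω => hCD hω, h.3, h.4⟩

theorem integral_convex_combination {f : Ω → Prices d} (hμ : Integrable f μ) (hν : Integrable f ν)
    {a b : ℝ} (ha : 0 ≤ a) (hb : 0 ≤ b) :
    ∫ ω, f ω ∂(ENNReal.ofReal a • μ + ENNReal.ofReal b • ν) =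
      a • ∫ ω, f ω ∂μ + b • ∫ ω, f ω ∂ν := by
  rw [integral_add_measure (hμ.smul_measure ENNReal.ofReal_ne_top)
    (hν.smul_measure ENNReal.ofReal_ne_top), integral_smul_measure, integral_smul_measure,
    ENNReal.toReal_ofReal ha, ENNReal.toReal_ofReal hb]

theorem IsMartingaleFrom.convex_combination (hμ : 𝓜.IsMartingaleFrom t C μ)
    (hν : 𝓜.IsMartingaleFrom t C ν) {a b : ℝ} (ha : 0 ≤ a) (hb : 0 ≤ b) (hab : a + b = 1) :
    𝓜.IsMartingaleFrom t C (ENNReal.ofReal a • μ + ENNReal.ofReal b • ν) := by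
  have := hμ.1
  have := hν.1
  refine ⟨⟨?_⟩, ?_, fun s => ?_, fun s hs A hA => ?_⟩
  · simp [← ENNReal.ofReal_add ha hb, hab]
  · exact ae_add_measure_iff.2 ⟨Measure.ae_smul_measure hμ.ae_mem _,
      Measure.ae_smul_measure hν.ae_mem _⟩
  · exact ((hμ.integrable s).smul_measure ENNReal.ofReal_ne_top).add_measure
      ((hν.integrable s).smul_measure ENNReal.ofReal_ne_top)
  · rw [Measure.restrict_add, Measure.restrict_smul, Measure.restrict_smul,
      integral_convex_combination (hμ.integrable_increment s).restrict
      (hν.integrable_increment s).restrict ha hb, hμ.setIntegral_eq_zero s hs A hA,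
      hν.setIntegral_eq_zero s hs A hA, smul_zero, smul_zero, add_zero]

theorem isMartingaleFrom_dirac [MeasurableSingletonClass Ω] (ω : Ω) :
    𝓜.IsMartingaleFrom (Fin.last T) (𝓜.levelSet (Fin.last T) ω) (Measure.dirac ω) := by
  refine ⟨inferInstance, ?_, fun s => integrable_dirac (by simp), fun s hs => ?_⟩
  · rw [ae_dirac_eq]
    exact mem_levelSet_self _ ω
  · exact absurd hs (not_le.2 (Fin.castSucc_lt_last s))

theorem IsMartingaleFrom.integral_increment {t : Fin T} {ω : Ω}
    (h : 𝓜.IsMartingaleFrom t.succ (𝓜.levelSet t.succ ω) μ) :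
    ∫ ω', 𝓜.increment t ω' ∂μ = 𝓜.increment t ω := by
  have := h.1
  rw [integral_congr_ae (h.ae_mem.mono fun _ h' => increment_eq_of_mem_levelSet h')]
  simp

/-- An event known at the date `t` cannot split a level set of that date, so the integral over it is
the whole mean or zero. -/
theorem IsMartingaleFrom.castSucc {t : Fin T} {ω : Ω}
    (h : 𝓜.IsMartingaleFrom t.succ (𝓜.levelSet t.castSucc ω) μ)
    (h0 : ∫ ω', 𝓜.increment t ω' ∂μ = 0) :
    𝓜.IsMartingaleFrom t.castSucc (𝓜.levelSet t.castSucc ω) μ := by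
  refine ⟨h.1, h.2, h.3, fun s hs A hA => ?_⟩
  rcases (Fin.castSucc_le_castSucc_iff.1 hs).eq_or_lt with rfl | hlt
  · by_cases hω : ω ∈ A
    · rw [Measure.restrict_eq_self_of_ae_mem
        (h.ae_mem.mono fun _ h' => (mem_iff_of_mem_levelSet hA h').2 hω), h0]
    · rw [Measure.restrict_eq_zero.2, integral_zero_measure]
      exact measure_eq_zero_iff_ae_notMem.2
        (h.ae_mem.mono fun _ h' => mt (mem_iff_of_mem_levelSet hA h').1 hω)
  · exact h.setIntegral_eq_zero s (Fin.succ_le_castSucc_iff.2 hlt) A hA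

/-- The attainable means form a convex set containing every surviving increment. -/
theorem exists_isMartingaleFrom_integral_eq {t : Fin T} {ω : Ω}
    (ih : ∀ ω ∈ 𝓜.survivors t.succ,
      ∃ μ, 𝓜.IsMartingaleFrom t.succ (𝓜.levelSet t.succ ω) μ)
    {x : Prices d} (hx : x ∈ convexHull ℝ
      (𝓜.increment t '' (𝓜.survivors t.succ ∩ 𝓜.levelSet t.castSucc ω))) :
    ∃ μ, 𝓜.IsMartingaleFrom t.succ (𝓜.levelSet t.castSucc ω) μ ∧
      ∫ ω', 𝓜.increment t ω' ∂μ = x := by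
  refine convexHull_min (t := {x | ∃ μ, 𝓜.IsMartingaleFrom t.succ (𝓜.levelSet t.castSucc ω) μ ∧
      ∫ ω', 𝓜.increment t ω' ∂μ = x}) ?_ ?_ hx
  · rintro _ ⟨ω', ⟨h1, h2⟩, rfl⟩
    obtain ⟨μ, hμ⟩ := ih ω' h1
    refine ⟨μ, hμ.mono ?_, hμ.integral_increment⟩
    rw [← levelSet_eq_of_mem h2]
    exact levelSet_antitone ω' (Fin.castSucc_lt_succ).le
  · rintro x ⟨μ, hμ, rfl⟩ y ⟨ν, hν, rfl⟩ a b ha hb hab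
    exact ⟨_, hμ.convex_combination hν ha hb hab, integral_convex_combination
      (hμ.integrable_increment t) (hν.integrable_increment t) ha hb⟩

theorem exists_isMartingaleFrom_of_mem_survivors [MeasurableSingletonClass Ω] (t : Fin (T + 1)) :
    ∀ ω ∈ 𝓜.survivors t, ∃ μ, 𝓜.IsMartingaleFrom t (𝓜.levelSet t ω) μ := by
  induction t using Fin.reverseInduction with
  | last => exact fun ω _ => ⟨_, isMartingaleFrom_dirac ω⟩
  | cast t ih =>
    intro ω hω
    obtain ⟨μ, hμ, h0⟩ := exists_isMartingaleFrom_integral_eq ih (mem_survivors_castSucc.1 hω).2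
    exact ⟨μ, hμ.castSucc h0⟩

theorem exists_isMartingaleFrom_charging [MeasurableSingletonClass Ω]
    {v : Set (Prices d) → ℕ → Prices d} (hv : IsSeparatorEnumeration v) {ω : Ω}
    (h : ∀ t, inner ℝ (𝓜.aggregator v t ω) (𝓜.increment t ω) = 0) (t : Fin (T + 1)) :
    ω ∈ 𝓜.survivors t ∧ ∃ μ, 𝓜.IsMartingaleFrom t (𝓜.levelSet t ω) μ ∧ 0 < μ {ω} := by
  induction t using Fin.reverseInduction with
  | last =>
    refine ⟨by simp [survivors_last], _, isMartingaleFrom_dirac ω, ?_⟩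
    simp
  | cast t ih =>
    obtain ⟨hω, μ, hμ, hpos⟩ := ih
    set Γ := 𝓜.survivors t.succ ∩ 𝓜.levelSet t.castSucc ω with hΓ
    have hmem : ω ∈ remainder v (𝓜.increment t) Γ (depth v (𝓜.increment t) Γ) :=
      mem_remainder_of_inner_layeredStrategy_eq_zero ⟨hω, mem_levelSet_self _ ω⟩ (h t)
    have hint := hv.zero_mem_intrinsicInterior_depth (𝓜.increment t) Γ
    have hsub : convexHull ℝ (𝓜.increment t ''
        remainder v (𝓜.increment t) Γ (depth v (𝓜.increment t) Γ)) ⊆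
        convexHull ℝ (𝓜.increment t '' Γ) := convexHull_mono (image_mono (remainder_subset _))
    refine ⟨mem_survivors_castSucc.2 ⟨hω, hsub (zero_mem_convexHull hint ⟨_, ω, hmem, rfl⟩)⟩, ?_⟩
    obtain ⟨c, hc, x, hx, hcx⟩ := exists_add_smul_eq_zero hint (mem_image_of_mem _ hmem)
    obtain ⟨ν, hν, hνx⟩ := exists_isMartingaleFrom_integral_eq
      (exists_isMartingaleFrom_of_mem_survivors t.succ) (hsub hx)
    have hc1 : 0 < 1 + c := by positivity
    have ha : 0 < 1 / (1 + c) := by positivity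
    have hb : 0 ≤ c / (1 + c) := by positivity
    have hμ' := hμ.mono (levelSet_antitone (𝓜 := 𝓜) ω (Fin.castSucc_lt_succ (i := t)).le)
    refine ⟨_, (hμ'.convex_combination hν ha.le hb (by field_simp)).castSucc ?_, ?_⟩
    · rw [integral_convex_combination (hμ.integrable_increment t) (hν.integrable_increment t)
        ha.le hb, hμ.integral_increment, hνx,
        show c / (1 + c) = 1 / (1 + c) * c by ring, mul_smul, ← smul_add, hcx, smul_zero]
    · rw [Measure.add_apply, Measure.smul_apply, smul_eq_mul]
      exact lt_of_lt_of_le (ENNReal.mul_pos (ENNReal.ofReal_pos.2 ha).ne' hpos.ne') le_self_add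

end TreeMeasures

/-! ### Countable mixtures and the martingale property -/

section Mixtures

theorem exists_isMartingaleFrom_absolutelyContinuous {t : Fin (T + 1)} {C : Set Ω}
    {μ : ℕ → Measure Ω} (hμ : ∀ n, 𝓜.IsMartingaleFrom t C (μ n)) :
    ∃ ν, 𝓜.IsMartingaleFrom t C ν ∧ ∀ n, μ n ≪ ν := by
  have hp := fun n => (hμ n).1
  -- `K n` dominates 1 and the first moments of all prices under `μ n`, so weights `2⁻¹ ^ n / K n`
  -- make total mass and moments summable.
  set K : ℕ → ENNReal := fun n => 1 + ∑ s, ∫⁻ ω, ‖𝓜.price s ω‖ₑ ∂μ n with hK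
  have hK0 : ∀ n, K n ≠ 0 := fun n => (lt_of_lt_of_le one_pos le_self_add).ne'
  have hKtop : ∀ n, K n ≠ ⊤ := fun n => ENNReal.add_ne_top.2
    ⟨ENNReal.one_ne_top, ENNReal.sum_ne_top.2 fun s _ => ((hμ n).integrable s).2.ne⟩
  set c : ℕ → ENNReal := fun n => 2⁻¹ ^ n * (K n)⁻¹ with hc
  have hc0 : ∀ n, c n ≠ 0 := fun n => mul_ne_zero (by simp) (ENNReal.inv_ne_zero.2 (hKtop n))
  have hcK : ∀ n, c n * K n = 2⁻¹ ^ n := fun n => by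
    rw [hc, mul_assoc, ENNReal.inv_mul_cancel (hK0 n) (hKtop n), mul_one]
  have hc_le : ∀ n, c n ≤ 2⁻¹ ^ n := fun n => by
    rw [← hcK n]; exact le_mul_of_one_le_right (zero_le) le_self_add
  have hgeom : ∑' n : ℕ, (2⁻¹ : ENNReal) ^ n = 2 := ENNReal.tsum_geometric_two
  set N : Measure Ω := Measure.sum fun n => c n • μ n with hN
  have hNuniv : N univ = ∑' n, c n := by simp [hN, Measure.sum_apply]
  have hN0 : N univ ≠ 0 := by
    rw [hNuniv]
    exact fun h => hc0 0 (ENNReal.tsum_eq_zero.1 h 0)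
  have hNfin : IsFiniteMeasure N := ⟨by
    rw [hNuniv]
    exact (ENNReal.tsum_le_tsum hc_le).trans_lt (hgeom.trans_lt ENNReal.ofNat_lt_top)⟩
  have hNne : NeZero N := ⟨fun h => hN0 (by simp [h])⟩
  have hinv : (N univ)⁻¹ ≠ ⊤ := ENNReal.inv_ne_top.2 hN0
  have hint : ∀ s, Integrable (𝓜.price s) N := by
    intro s
    refine ⟨(𝓜.measurable_price s).aestronglyMeasurable, ?_⟩
    rw [HasFiniteIntegral, hN, lintegral_sum_measure]
    refine lt_of_le_of_lt (ENNReal.tsum_le_tsum fun n => ?_) (hgeom.trans_lt ENNReal.ofNat_lt_top)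
    rw [lintegral_smul_measure, smul_eq_mul, ← hcK n]
    gcongr
    exact (Finset.single_le_sum (f := fun s => ∫⁻ ω, ‖𝓜.price s ω‖ₑ ∂μ n)
      (fun _ _ => zero_le) (Finset.mem_univ s)).trans le_add_self
  refine ⟨(N univ)⁻¹ • N, ⟨isProbabilityMeasureSMul, ?_, fun s => (hint s).smul_measure hinv,
    fun s hs A hA => ?_⟩, fun n => ?_⟩
  · exact Measure.ae_smul_measure
      (Measure.ae_sum_iff.2 fun n => Measure.ae_smul_measure (hμ n).ae_mem _) _
  · rw [Measure.restrict_smul, integral_smul_measure, hN,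
      Measure.restrict_sum _ (𝓜.filtration.le _ A hA)]
    have hi : Integrable (𝓜.increment s)
        (Measure.sum fun n => (c n • μ n).restrict A) := by
      rw [← Measure.restrict_sum _ (𝓜.filtration.le _ A hA)]
      exact ((hint _).sub (hint _)).restrict
    have h0 : ∀ n, ∫ ω, 𝓜.increment s ω ∂((c n • μ n).restrict A) = 0 := fun n => by
      rw [Measure.restrict_smul, integral_smul_measure, (hμ n).setIntegral_eq_zero s hs A hA,
        smul_zero]
    rw [← (hasSum_integral_measure hi).tsum_eq, tsum_congr h0, tsum_zero, smul_zero]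
  · refine Measure.AbsolutelyContinuous.trans ?_
      (Measure.AbsolutelyContinuous.rfl.smul_right (ENNReal.inv_ne_zero.2 (measure_ne_top N univ)))
    refine Measure.AbsolutelyContinuous.trans (Measure.AbsolutelyContinuous.rfl.smul_right (hc0 n)) ?_
    exact (Measure.le_sum (fun n => c n • μ n) n).absolutelyContinuous

theorem IsMartingaleFrom.setIntegral_eq {C : Set Ω} {μ : Measure Ω}
    (h : 𝓜.IsMartingaleFrom 0 C μ) {i : Fin (T + 1)} {A : Set Ω}
    (hA : MeasurableSet[𝓜.filtration i] A) (j : Fin (T + 1)) (hij : i ≤ j) :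
    ∫ ω in A, 𝓜.price i ω ∂μ = ∫ ω in A, 𝓜.price j ω ∂μ := by
  induction j using Fin.induction with
  | zero => rw [Fin.le_zero_iff.1 hij]
  | succ j ih =>
    rcases hij.eq_or_lt with rfl | hlt
    · rfl
    · have hle : i ≤ j.castSucc := Fin.le_castSucc_iff.2 hlt
      rw [ih hle, ← sub_eq_zero, ← neg_eq_zero, neg_sub,
        ← integral_sub (h.integrable _).restrict (h.integrable _).restrict]
      exact h.setIntegral_eq_zero j (Fin.zero_le _) A (𝓜.filtration.mono hle A hA)

theorem IsMartingaleFrom.martingale {C : Set Ω} {μ : Measure Ω} (h : 𝓜.IsMartingaleFrom 0 C μ) :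
    Martingale 𝓜.price 𝓜.filtration μ := by
  have := h.1
  refine ⟨stronglyMeasurable_price, fun i j hij => ?_⟩
  refine (ae_eq_condExp_of_forall_setIntegral_eq (𝓜.filtration.le i) (h.integrable j)
    (fun _ _ _ => (h.integrable i).integrableOn) (fun A hA _ => h.setIntegral_eq hA j hij)
    (stronglyMeasurable_price i).aestronglyMeasurable).symm

end Mixtures

end Market

/-! ### Regular conditional probabilities -/

section ConditionalKernel

open ProbabilityTheory

variable {Ω : Type*} {m : MeasurableSpace Ω} [mΩ : MeasurableSpace Ω] [StandardBorelSpace Ω]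
  {μ : Measure Ω} [IsProbabilityMeasure μ]

theorem ae_condExpKernel_ae_mem (hm : m ≤ mΩ) {B : Set Ω} (hB : MeasurableSet[m] B) :
    ∀ᵐ ω ∂μ, ω ∈ B → ∀ᵐ y ∂condExpKernel μ m ω, y ∈ B := by
  have h := condExpKernel_ae_eq_condExp (μ := μ) hm (hm _ hB.compl)
  rw [condExp_of_stronglyMeasurable hm (stronglyMeasurable_const.indicator hB.compl)
    ((integrable_const (1 : ℝ)).indicator (hm _ hB.compl))] at h
  filter_upwards [h] with ω hω hmem
  rw [indicator_of_notMem (notMem_compl_iff.2 hmem), measureReal_eq_zero_iff] at hω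
  exact measure_eq_zero_iff_ae_notMem.1 hω |>.mono fun y hy => notMem_compl_iff.1 hy

/-- The points whose kernel neglects `B` form an event of `m`; integrating the kernel over it shows
that it meets `B` in a null set. -/
theorem ae_condExpKernel_ne_zero (hm : m ≤ mΩ) {B : Set Ω} (hB : MeasurableSet B) :
    ∀ᵐ ω ∂μ, ω ∈ B → condExpKernel μ m ω B ≠ 0 := by
  set N : Set Ω := {ω | condExpKernel μ m ω B = 0} with hN
  have hNm : MeasurableSet[m] N := measurable_condExpKernel hB (measurableSet_singleton 0)
  have h1 : ∫ ω in N, (condExpKernel μ m ω).real B ∂μ = ∫ ω in N, (μ⟦B | m⟧) ω ∂μ :=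
    integral_congr_ae (ae_restrict_of_ae (condExpKernel_ae_eq_condExp hm hB))
  have h2 : ∫ ω in N, (condExpKernel μ m ω).real B ∂μ = 0 := by
    refine setIntegral_eq_zero_of_forall_eq_zero fun ω hω => ?_
    rw [measureReal_eq_zero_iff]
    exact hω
  rw [h2, setIntegral_condExp hm ((integrable_const (1 : ℝ)).indicator hB) hNm,
    setIntegral_indicator hB, setIntegral_const, smul_eq_mul, mul_one, eq_comm,
    measureReal_eq_zero_iff] at h1
  filter_upwards [measure_eq_zero_iff_ae_notMem.1 h1] with ω hω hB h0
  exact hω ⟨h0, hB⟩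

theorem ae_ae_condExpKernel (hm : m ≤ mΩ) {p : Ω → Prop} (hp : ∀ᵐ ω ∂μ, p ω) :
    ∀ᵐ ω ∂μ, ∀ᵐ y ∂condExpKernel μ m ω, p y := by
  have : ∀ᵐ ω ∂(condExpKernel μ m ∘ₘ μ.trim hm), p ω := by
    rwa [condExpKernel_comp_trim]
  exact ae_of_ae_trim hm (Measure.ae_ae_of_ae_comp this)

/-- A countable basis separates points, so countably many events of `m` determine the value of `f`.
-/
theorem ae_condExpKernel_ae_eq {E : Type*} [TopologicalSpace E] [SecondCountableTopology E]
    [T2Space E] [MeasurableSpace E] [OpensMeasurableSpace E] (hm : m ≤ mΩ) {f : Ω → E}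
    (hf : Measurable[m] f) : ∀ᵐ ω ∂μ, ∀ᵐ y ∂condExpKernel μ m ω, f y = f ω := by
  set b := TopologicalSpace.countableBasis E
  have hb : ∀ U ∈ b, ∀ᵐ ω ∂μ, f ω ∈ U → ∀ᵐ y ∂condExpKernel μ m ω, f y ∈ U := fun U hU =>
    ae_condExpKernel_ae_mem hm
      (hf ((TopologicalSpace.isOpen_of_mem_countableBasis hU).measurableSet))
  have hc : b.Countable := TopologicalSpace.countable_countableBasis E
  filter_upwards [(ae_ball_iff hc).2 hb] with ω hω
  have : ∀ᵐ y ∂condExpKernel μ m ω, ∀ U ∈ b, f ω ∈ U → f y ∈ U := by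
    rw [ae_ball_iff hc]
    intro U hU
    by_cases h : f ω ∈ U
    · exact (hω U hU h).mono fun y hy _ => hy
    · exact Filter.Eventually.of_forall fun y h' => absurd h' h
  filter_upwards [this] with y hy
  by_contra hne
  obtain ⟨U, V, hU, -, hyU, hωV, hd⟩ := t2_separation (Ne.symm hne)
  obtain ⟨W, hW, hωW, hWU⟩ :=
    (TopologicalSpace.isBasis_countableBasis E).exists_subset_of_mem_open hyU hU
  exact hd.ne_of_mem (hWU (hy W hW hωW)) hωV rfl

end ConditionalKernel

/-! ### The decomposition under a law with mean-zero increment -/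

section LayersUnderMeasure

variable {Ω : Type*} [MeasurableSpace Ω] {d : ℕ} {v : Set (Prices d) → ℕ → Prices d}
  {X : Ω → Prices d} {Γ : Set Ω} {P : Measure Ω}

/-- A nonnegative gain with mean zero vanishes a.e., so every layer is null. -/
theorem IsSeparatorEnumeration.ae_mem_remainder (hv : IsSeparatorEnumeration v)
    (hX : Integrable X P) (h0 : ∫ ω, X ω ∂P = 0) (hΓ : ∀ᵐ ω ∂P, ω ∈ Γ) (i : ℕ) :
    (∀ᵐ ω ∂P, ω ∈ remainder v X Γ i) ∧ ∀ᵐ ω ∂P, inner ℝ (layerStrategy v X Γ i) (X ω) = 0 := by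
  have key : ∀ i, (∀ᵐ ω ∂P, ω ∈ remainder v X Γ i) →
      ∀ᵐ ω ∂P, inner ℝ (layerStrategy v X Γ i) (X ω) = 0 := by
    intro i hi
    have hnn : 0 ≤ᵐ[P] fun ω => inner ℝ (layerStrategy v X Γ i) (X ω) :=
      hi.mono fun ω hω => hv.layerStrategy_nonneg hω
    refine (integral_eq_zero_iff_of_nonneg_ae hnn (hX.const_inner _)).1 ?_
    rw [integral_inner hX, h0, inner_zero_right]
  have hmem : ∀ᵐ ω ∂P, ω ∈ remainder v X Γ i := by
    induction i with
    | zero => exact hΓ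
    | succ i ih =>
      filter_upwards [ih, key i ih] with ω h1 h2
      exact ⟨h1, fun h => h.ne' h2⟩
  exact ⟨hmem, key i hmem⟩

/-- The aggregator is evaluated at a point that `P` need not charge. It suffices that `X ω` lies in
the support of the law of `X`: the open half-space of positive gains is null. Testing on a countable
basis keeps the exceptional sets countable in number. -/
theorem IsSeparatorEnumeration.forall_mem_remainder (hv : IsSeparatorEnumeration v)
    (hX : Integrable X P) (h0 : ∫ ω, X ω ∂P = 0) (hΓ : ∀ᵐ ω ∂P, ω ∈ Γ) {ω : Ω} (hω : ω ∈ Γ)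
    (hsupp : ∀ U ∈ TopologicalSpace.countableBasis (Prices d), X ω ∈ U → P (X ⁻¹' U) ≠ 0) (i : ℕ) :
    ω ∈ remainder v X Γ i := by
  induction i with
  | zero => exact hω
  | succ i ih =>
    refine ⟨ih, fun hpos => ?_⟩
    have hopen : IsOpen {y : Prices d | 0 < inner ℝ (layerStrategy v X Γ i) y} :=
      isOpen_lt continuous_const (by fun_prop)
    obtain ⟨U, hU, hωU, hsub⟩ := (TopologicalSpace.isBasis_countableBasis
      (Prices d)).exists_subset_of_mem_open (a := X ω) hpos hopen
    refine hsupp U hU hωU (measure_eq_zero_iff_ae_notMem.2 ?_)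
    filter_upwards [(hv.ae_mem_remainder hX h0 hΓ i).2] with y hy hyU
    exact (hsub hyU : 0 < inner ℝ (layerStrategy v X Γ i) (X y)).ne' hy

end LayersUnderMeasure

/-! ### The aggregator vanishes under martingale measures -/

namespace Market

variable {Ω : Type*} [MeasurableSpace Ω] {d T : ℕ} {𝓜 : Market Ω d T}
  {Q : Measure Ω} {v : Set (Prices d) → ℕ → Prices d}

theorem condExp_increment (hQ : Martingale 𝓜.price 𝓜.filtration Q) (t : Fin T) :
    Q[𝓜.increment t | 𝓜.filtration t.castSucc] =ᵐ[Q] 0 := by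
  have h1 := hQ.condExp_ae_eq (Fin.castSucc_lt_succ (i := t)).le
  have h2 := hQ.condExp_ae_eq (le_refl t.castSucc)
  have h3 := condExp_sub (hQ.integrable t.succ) (hQ.integrable t.castSucc)
    (𝓜.filtration t.castSucc)
  filter_upwards [h1, h2, h3] with ω h1 h2 h3
  rw [show 𝓜.increment t = 𝓜.price t.succ - 𝓜.price t.castSucc from rfl, h3, Pi.sub_apply, h1, h2,
    sub_self, Pi.zero_apply]

variable [StandardBorelSpace Ω] [IsProbabilityMeasure Q]

/-- The decomposition is run under the conditional law given the date `t`, which lives on the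
surviving part of the level set and gives the increment mean zero. -/
theorem ae_mem_survivors_step (hv : IsSeparatorEnumeration v)
    (hQ : Martingale 𝓜.price 𝓜.filtration Q) (t : Fin T)
    (ih : ∀ᵐ ω ∂Q, ω ∈ 𝓜.survivors t.succ) :
    ∀ᵐ ω ∂Q, ω ∈ 𝓜.survivors t.castSucc ∧ 𝓜.aggregator v t ω = 0 := by
  have hm := 𝓜.filtration.le t.castSucc
  have hint : Integrable (𝓜.increment t) Q := (hQ.integrable _).sub (hQ.integrable _)
  have hlevel : ∀ s ≤ t.castSucc, ∀ᵐ ω ∂Q, ∀ᵐ y ∂ProbabilityTheory.condExpKernel Q (𝓜.filtration t.castSucc) ω,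
      𝓜.price s y = 𝓜.price s ω := fun s hs =>
    ae_condExpKernel_ae_eq hm (measurable_price_filtration hs)
  have hsupp : ∀ U ∈ TopologicalSpace.countableBasis (Prices d), ∀ᵐ ω ∂Q,
      ω ∈ 𝓜.increment t ⁻¹' U →
        ProbabilityTheory.condExpKernel Q (𝓜.filtration t.castSucc) ω (𝓜.increment t ⁻¹' U) ≠ 0 := fun U hU =>
    ae_condExpKernel_ne_zero hm (measurable_increment t
      (TopologicalSpace.isOpen_of_mem_countableBasis hU).measurableSet)
  filter_upwards [ih, ae_ae_condExpKernel hm ih, (ae_ball_iff (to_countable (Iic t.castSucc))).2 hlevel,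
    (ae_ball_iff (TopologicalSpace.countable_countableBasis _)).2 hsupp, hint.condExpKernel_ae,
    condExp_increment hQ t, ProbabilityTheory.condExp_ae_eq_integral_condExpKernel hm hint]
    with ω hω hκ hlev hsup hi h1 h2
  have hΓ : ∀ᵐ y ∂ProbabilityTheory.condExpKernel Q (𝓜.filtration t.castSucc) ω,
      y ∈ 𝓜.survivors t.succ ∩ 𝓜.levelSet t.castSucc ω :=
    hκ.and ((ae_ball_iff (to_countable (Iic t.castSucc))).2 hlev)
  have h0 : ∫ y, 𝓜.increment t y ∂ProbabilityTheory.condExpKernel Q (𝓜.filtration t.castSucc) ω = 0 := by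
    rw [← h2, h1, Pi.zero_apply]
  have hrem := hv.forall_mem_remainder hi h0 hΓ ⟨hω, mem_levelSet_self _ ω⟩ hsup
  refine ⟨mem_survivors_castSucc.2 ⟨hω, ?_⟩, layeredStrategy_eq_zero_of_forall_mem hrem⟩
  exact convexHull_mono (image_mono (remainder_subset _))
    (zero_mem_convexHull (hv.zero_mem_intrinsicInterior_depth _ _) ⟨_, ω, hrem _, rfl⟩)

theorem ae_mem_survivors (hv : IsSeparatorEnumeration v)
    (hQ : Martingale 𝓜.price 𝓜.filtration Q) (t : Fin (T + 1)) :
    ∀ᵐ ω ∂Q, ω ∈ 𝓜.survivors t := by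
  induction t using Fin.reverseInduction with
  | last => simp [survivors_last]
  | cast t ih => exact (ae_mem_survivors_step hv hQ t ih).mono fun _ h => h.1

theorem aggregator_ae_eq_zero (hv : IsSeparatorEnumeration v)
    (hQ : Martingale 𝓜.price 𝓜.filtration Q) (t : Fin T) : 𝓜.aggregator v t =ᵐ[Q] 0 :=
  (ae_mem_survivors_step hv hQ t (ae_mem_survivors hv hQ t.succ)).mono fun _ h => h.2

/-- Preimages under an a.e. vanishing map are null or conull. -/
theorem enlargedFiltration_le (hv : IsSeparatorEnumeration v)
    (hQ : Martingale 𝓜.price 𝓜.filtration Q) (t : Fin (T + 1)) :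
    𝓜.enlargedFiltration v t ≤ eventuallyMeasurableSpace (𝓜.filtration t) (ae Q) := by
  refine sup_le (le_eventuallyMeasurableSpace) (iSup₂_le fun s _ => ?_)
  rintro _ ⟨B, -, rfl⟩
  have h := aggregator_ae_eq_zero hv hQ s
  by_cases h0 : (0 : Prices d) ∈ B
  · refine ⟨univ, @MeasurableSet.univ _ (𝓜.filtration t), Filter.eventuallyEq_univ.2 ?_⟩
    filter_upwards [h] with ω hω
    rwa [mem_preimage, hω]
  · refine ⟨∅, @MeasurableSet.empty _ (𝓜.filtration t), Filter.eventuallyEq_empty.2 ?_⟩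
    filter_upwards [h] with ω hω
    rwa [mem_preimage, hω]

end Market

/-! ### Measurable versions -/

section EventuallyMeasurable

/-- Countably many generators are corrected simultaneously off a null set. On the conull set `W`,
not necessarily measurable, `f` is measurable for the trace of `m`, and it extends because `E` is
standard Borel. -/
theorem exists_measurable_ae_eq_of_eventuallyMeasurable {Ω E : Type*}
    {m : MeasurableSpace Ω} [MeasurableSpace Ω] {μ : Measure Ω} [Nonempty E] [MeasurableSpace E] [StandardBorelSpace E]
    {f : Ω → E} (hf : Measurable[eventuallyMeasurableSpace m (ae μ)] f) :
    ∃ g : Ω → E, Measurable[m] g ∧ f =ᵐ[μ] g := by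
  obtain ⟨S, hS, hgen⟩ := (inferInstance : MeasurableSpace.CountablyGenerated E).1
  have hT : ∀ s ∈ S, ∃ t, MeasurableSet[m] t ∧ f ⁻¹' s =ᵐ[μ] t := fun s hs =>
    hf (hgen ▸ MeasurableSpace.measurableSet_generateFrom hs)
  choose! t htm ht using hT
  set W : Set Ω := {ω | ∀ s ∈ S, (f ω ∈ s ↔ ω ∈ t s)} with hW
  have hWae : ∀ᵐ ω ∂μ, ω ∈ W :=
    (ae_ball_iff hS).2 fun s hs => (ht s hs).mem_iff
  have hmeas : Measurable[m.comap ((↑) : W → Ω)] fun x : W => f x := by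
    rw [hgen]
    refine @measurable_generateFrom _ _ (m.comap ((↑) : W → Ω)) _ _ fun s hs => ?_
    exact ⟨t s, htm s hs, by ext x; exact (x.2 s hs).symm⟩
  obtain ⟨g, hg, hfg⟩ := Measurable.exists_eq_measurable_comp (mY := m) hmeas
  exact ⟨g, hg, hWae.mono fun ω hω => congrFun hfg ⟨ω, hω⟩⟩

end EventuallyMeasurable

/-! ### One-period martingale transforms -/

section MartingaleTransforms

variable {Ω : Type*} {m mΩ : MeasurableSpace Ω} {μ : Measure Ω} [IsProbabilityMeasure μ] {d : ℕ}
  {G X : Ω → Prices d}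

/-- Restricting to `‖G ω‖ ≤ n` lets `G` be pulled out of the conditional expectation with no
integrability assumed; the gain is nonnegative with mean zero. -/
theorem inner_ae_eq_zero_of_nonneg_on (hm : m ≤ mΩ) (hG : Measurable[m] G) (hX : Integrable X μ)
    (h0 : μ[X | m] =ᵐ[μ] 0) {A : Set Ω} (hA : MeasurableSet[m] A)
    (hnn : ∀ᵐ ω ∂μ, ω ∈ A → 0 ≤ inner ℝ (G ω) (X ω)) :
    ∀ᵐ ω ∂μ, ω ∈ A → inner ℝ (G ω) (X ω) = 0 := by
  have key : ∀ n : ℕ, ∀ᵐ ω ∂μ, ω ∈ A ∩ {ω | ‖G ω‖ ≤ n} → inner ℝ (G ω) (X ω) = 0 := by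
    intro n
    set B : Set Ω := A ∩ {ω | ‖G ω‖ ≤ n} with hB
    have hBm : MeasurableSet[m] B :=
      @MeasurableSet.inter _ m _ _ hA (measurable_norm.comp hG measurableSet_Iic)
    have hGB : StronglyMeasurable[m] (B.indicator G) := (hG.indicator hBm).stronglyMeasurable
    have hbound : ∀ ω, ‖B.indicator G ω‖ ≤ n := by
      intro ω
      by_cases hω : ω ∈ B
      · rw [indicator_of_mem hω]; exact hω.2
      · rw [indicator_of_notMem hω, norm_zero]; positivity
    have hpull := condExp_stronglyMeasurable_bilin_of_bound (μ := μ)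
      (innerSL ℝ : Prices d →L[ℝ] Prices d →L[ℝ] ℝ) hm hGB hX n
      (Filter.Eventually.of_forall hbound)
    have hint : Integrable (fun ω => inner ℝ (B.indicator G ω) (X ω)) μ := by
      refine (hX.norm.const_mul (n : ℝ)).mono' ((hGB.mono hm).aestronglyMeasurable.inner hX.1)
        (Filter.Eventually.of_forall fun ω => ?_)
      exact (norm_inner_le_norm _ _).trans
        (mul_le_mul_of_nonneg_right (hbound ω) (norm_nonneg _))
    have hzero : ∫ ω, inner ℝ (B.indicator G ω) (X ω) ∂μ = 0 := by
      rw [← integral_condExp hm]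
      refine integral_eq_zero_of_ae (hpull.trans ?_)
      filter_upwards [h0] with ω hω
      simp [hω]
    have hnonneg : 0 ≤ᵐ[μ] fun ω => inner ℝ (B.indicator G ω) (X ω) := by
      filter_upwards [hnn] with ω hω
      by_cases hωB : ω ∈ B
      · simpa [indicator_of_mem hωB] using hω hωB.1
      · simp [indicator_of_notMem hωB]
    filter_upwards [(integral_eq_zero_iff_of_nonneg_ae hnonneg hint).1 hzero] with ω hω hωB
    simpa [indicator_of_mem hωB] using hω
  filter_upwards [ae_all_iff.2 key] with ω hω hωA
  obtain ⟨n, hn⟩ := exists_nat_ge ‖G ω‖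
  exact hω n ⟨hωA, hn⟩

/-- Where `Y` is negative the gain would be positive, yet it vanishes a.e. there. -/
theorem ae_nonneg_of_add_inner_nonneg (hm : m ≤ mΩ) (hG : Measurable[m] G) (hX : Integrable X μ)
    (h0 : μ[X | m] =ᵐ[μ] 0) {Y : Ω → ℝ} (hY : Measurable[m] Y)
    (hnn : ∀ᵐ ω ∂μ, 0 ≤ Y ω + inner ℝ (G ω) (X ω)) : ∀ᵐ ω ∂μ, 0 ≤ Y ω := by
  have hA : MeasurableSet[m] {ω | Y ω < 0} := hY measurableSet_Iio
  have h := inner_ae_eq_zero_of_nonneg_on hm hG hX h0 hA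
    (hnn.mono fun ω hω (hY : Y ω < 0) => by linarith)
  filter_upwards [hnn, h] with ω h1 h2
  by_contra! hlt
  linarith [h2 hlt]

end MartingaleTransforms

/-! ### Final values under martingale measures, and the equivalence -/

namespace Market

variable {Ω : Type*} [MeasurableSpace Ω] {d T : ℕ} {𝓜 : Market Ω d T}

/-- The value, at the date `t`, of a self-financing strategy with zero initial cost. -/
def gain (𝓜 : Market Ω d T) (G : Fin T → Ω → Prices d) (t : Fin (T + 1)) (ω : Ω) : ℝ :=
  ∑ s : Fin T, if s.castSucc < t then inner ℝ (G s ω) (𝓜.increment s ω) else 0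

theorem gain_zero (G : Fin T → Ω → Prices d) (ω : Ω) : 𝓜.gain G 0 ω = 0 := by
  simp [gain]

theorem gain_last (G : Fin T → Ω → Prices d) (ω : Ω) :
    𝓜.gain G (Fin.last T) ω = 𝓜.finalValue G ω := by
  simp [gain, finalValue, Fin.castSucc_lt_last]

theorem gain_succ (G : Fin T → Ω → Prices d) (t : Fin T) (ω : Ω) :
    𝓜.gain G t.succ ω = 𝓜.gain G t.castSucc ω + inner ℝ (G t ω) (𝓜.increment t ω) := by
  have h : ∀ s : Fin T, (if s.castSucc < t.succ then inner ℝ (G s ω) (𝓜.increment s ω) else 0) =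
      (if s.castSucc < t.castSucc then inner ℝ (G s ω) (𝓜.increment s ω) else 0) +
        if s = t then inner ℝ (G s ω) (𝓜.increment s ω) else 0 := by
    intro s
    rcases lt_trichotomy s t with hlt | rfl | hlt
    · simp [Fin.castSucc_lt_succ_iff, hlt, hlt.le, hlt.ne]
    · simp
    · simp [Fin.castSucc_lt_succ_iff, not_le.2 hlt, not_lt.2 hlt.le, hlt.ne']
  simp only [gain, h, Finset.sum_add_distrib, Finset.sum_ite_eq', Finset.mem_univ, if_true]

theorem measurable_gain {G : Fin T → Ω → Prices d}
    (hG : ∀ t : Fin T, Measurable[𝓜.filtration t.castSucc] (G t)) (t : Fin (T + 1)) :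
    Measurable[𝓜.filtration t] (𝓜.gain G t) := by
  induction t using Fin.induction with
  | zero =>
    rw [show 𝓜.gain G 0 = fun _ => 0 from funext (gain_zero G)]
    exact measurable_const
  | succ t ih =>
    rw [show 𝓜.gain G t.succ = fun ω => 𝓜.gain G t.castSucc ω +
      inner ℝ (G t ω) (𝓜.increment t ω) from funext (gain_succ G t)]
    have hle := 𝓜.filtration.mono (Fin.castSucc_lt_succ (i := t)).le
    have hinc : Measurable[𝓜.filtration t.succ] (𝓜.increment t) :=
      (measurable_price_filtration le_rfl).sub
        (measurable_price_filtration (Fin.castSucc_lt_succ (i := t)).le)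
    exact (ih.mono hle le_rfl).add (((hG t).mono hle le_rfl).inner hinc)

/-- Nonnegativity passes backwards to all intermediate values; then, forwards from 0, each period's
gain is nonnegative and hence null. The values need not be integrable. -/
theorem finalValue_ae_eq_zero {Q : Measure Ω} [IsProbabilityMeasure Q]
    (hQ : Martingale 𝓜.price 𝓜.filtration Q) {G : Fin T → Ω → Prices d}
    (hG : ∀ t : Fin T, Measurable[𝓜.filtration t.castSucc] (G t))
    (hnn : ∀ᵐ ω ∂Q, 0 ≤ 𝓜.finalValue G ω) : ∀ᵐ ω ∂Q, 𝓜.finalValue G ω = 0 := by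
  have hint : ∀ t, Integrable (𝓜.increment t) Q := fun t =>
    (hQ.integrable _).sub (hQ.integrable _)
  have hback : ∀ t, ∀ᵐ ω ∂Q, 0 ≤ 𝓜.gain G t ω := by
    intro t
    induction t using Fin.reverseInduction with
    | last => simpa only [gain_last] using hnn
    | cast t ih =>
      refine ae_nonneg_of_add_inner_nonneg (𝓜.filtration.le t.castSucc) (hG t) (hint t)
        (condExp_increment hQ t) (measurable_gain hG _) ?_
      simpa only [gain_succ] using ih
  have hforw : ∀ t, ∀ᵐ ω ∂Q, 𝓜.gain G t ω = 0 := by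
    intro t
    induction t using Fin.induction with
    | zero => exact Filter.Eventually.of_forall (gain_zero G)
    | succ t ih =>
      have h := inner_ae_eq_zero_of_nonneg_on (𝓜.filtration.le t.castSucc) (hG t) (hint t)
        (condExp_increment hQ t) (@MeasurableSet.univ _ (𝓜.filtration t.castSucc)) (by
          filter_upwards [ih, hback t.succ] with ω h1 h2 _
          rwa [gain_succ, h1, zero_add] at h2)
      filter_upwards [ih, h] with ω h1 h2
      rw [gain_succ, h1, h2 (mem_univ ω), add_zero]
  simpa only [gain_last] using hforw (Fin.last T)

theorem finalValue_ae_eq_zero_of_mem_enlargedStrategies [StandardBorelSpace Ω] {Q : Measure Ω}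
    [IsProbabilityMeasure Q] {v : Set (Prices d) → ℕ → Prices d} (hv : IsSeparatorEnumeration v)
    (hQ : Martingale 𝓜.price 𝓜.filtration Q) {H : Fin T → Ω → Prices d}
    (hH : H ∈ 𝓜.enlargedStrategies v) (hnn : ∀ ω, 0 ≤ 𝓜.finalValue H ω) :
    ∀ᵐ ω ∂Q, 𝓜.finalValue H ω = 0 := by
  have hex : ∀ t : Fin T, ∃ g, Measurable[𝓜.filtration t.castSucc] g ∧ H t =ᵐ[Q] g := fun t =>
    exists_measurable_ae_eq_of_eventuallyMeasurable
      ((hH t).mono (enlargedFiltration_le hv hQ t.castSucc) le_rfl)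
  choose G hG hHG using hex
  have heq : ∀ᵐ ω ∂Q, 𝓜.finalValue H ω = 𝓜.finalValue G ω := by
    filter_upwards [ae_all_iff.2 hHG] with ω hω
    simp only [finalValue, hω]
  have h := finalValue_ae_eq_zero hQ hG (heq.mono fun ω hω => hω ▸ hnn ω)
  filter_upwards [heq, h] with ω h1 h2
  rw [h1, h2]

theorem noArbitrage_of_nonempty [StandardBorelSpace Ω] {v : Set (Prices d) → ℕ → Prices d}
    (hv : IsSeparatorEnumeration v) {𝒮 : Set (Set Ω)}
    (h : (𝓜.martingaleMeasures ∩ chargingMeasures 𝒮).Nonempty) : 𝓜.NoArbitrage v 𝒮 := by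
  rintro ⟨H, hH, hnn, C, hC, hpos⟩
  obtain ⟨Q, hQ, hcharge⟩ := h
  have h0 := finalValue_ae_eq_zero_of_mem_enlargedStrategies hv hQ hH hnn
  refine (hcharge C hC).ne' (measure_eq_zero_iff_ae_notMem.2 ?_)
  filter_upwards [h0] with ω hω hωC
  exact (hpos hωC : 0 < 𝓜.finalValue H ω).ne' hω

theorem aggregator_mem_enlargedStrategies (v : Set (Prices d) → ℕ → Prices d) :
    𝓜.aggregator v ∈ 𝓜.enlargedStrategies v := by
  intro t
  refine (comap_measurable (𝓜.aggregator v t)).mono ?_ le_rfl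
  exact le_sup_of_le_right (le_iSup₂_of_le t le_rfl le_rfl)

theorem exists_isMartingaleFrom_of_noArbitrage [MeasurableSingletonClass Ω]
    {v : Set (Prices d) → ℕ → Prices d} (hv : IsSeparatorEnumeration v) {𝒮 : Set (Set Ω)}
    (h : 𝓜.NoArbitrage v 𝒮) {C : Set Ω} (hC : C ∈ 𝒮) :
    ∃ μ, 𝓜.IsMartingaleFrom 0 univ μ ∧ 0 < μ C := by
  have hnn : ∀ t ω, 0 ≤ inner ℝ (𝓜.aggregator v t ω) (𝓜.increment t ω) := fun t ω =>
    inner_layeredStrategy_nonneg ω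
  have hsub : ¬ C ⊆ {ω | 0 < 𝓜.finalValue (𝓜.aggregator v) ω} := fun hsub =>
    h ⟨_, aggregator_mem_enlargedStrategies v,
      fun ω => Finset.sum_nonneg fun t _ => hnn t ω, C, hC, hsub⟩
  obtain ⟨ω, hωC, hω⟩ := not_subset.1 hsub
  have h0 : 𝓜.finalValue (𝓜.aggregator v) ω = 0 :=
    le_antisymm (not_lt.1 hω) (Finset.sum_nonneg fun t _ => hnn t ω)
  have hzero := (Finset.sum_eq_zero_iff_of_nonneg fun t _ => hnn t ω).1 h0
  obtain ⟨-, μ, hμ, hpos⟩ :=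
    exists_isMartingaleFrom_charging hv (fun t => hzero t (Finset.mem_univ t)) 0
  exact ⟨μ, hμ.mono (subset_univ _),
    hpos.trans_le (measure_mono (singleton_subset_iff.2 hωC))⟩

theorem noArbitrage_iff [StandardBorelSpace Ω] {v : Set (Prices d) → ℕ → Prices d}
    (hv : IsSeparatorEnumeration v) {𝒮 : Set (Set Ω)} (h𝒮 : HasCountableCore 𝒮) :
    𝓜.NoArbitrage v 𝒮 ↔ (𝓜.martingaleMeasures ∩ chargingMeasures 𝒮).Nonempty := by
  refine ⟨fun h => ?_, noArbitrage_of_nonempty hv⟩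
  obtain ⟨C, hC, hcore⟩ := h𝒮
  choose μ hμ hpos using fun n => exists_isMartingaleFrom_of_noArbitrage hv h (hC n)
  obtain ⟨ν, hν, hac⟩ := exists_isMartingaleFrom_absolutelyContinuous hμ
  refine ⟨⟨ν, hν.1⟩, hν.martingale, fun D hD => ?_⟩
  obtain ⟨n, hn⟩ := hcore D hD
  refine lt_of_lt_of_le (pos_iff_ne_zero.2 fun h0 => ?_) (measure_mono hn)
  exact (hpos n).ne' (hac n h0)

end Market

/-! ### Open sets and full support -/

theorem hasCountableCore_nonemptyOpens (Ω : Type*) [TopologicalSpace Ω]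
    [SecondCountableTopology Ω] [Nonempty Ω] : HasCountableCore (nonemptyOpens Ω) := by
  set b := TopologicalSpace.countableBasis Ω
  have hb := TopologicalSpace.isBasis_countableBasis Ω
  obtain ⟨x⟩ := ‹Nonempty Ω›
  -- A sequence can enumerate the basis only if the basis is nonempty, which uses a point of `Ω`.
  obtain ⟨U, hU, -, -⟩ := hb.exists_subset_of_mem_open (mem_univ x) isOpen_univ
  obtain ⟨C, hC⟩ := (TopologicalSpace.countable_countableBasis Ω).exists_eq_range ⟨U, hU⟩
  have hCb : ∀ n, C n ∈ b := fun n => by rw [show b = range C from hC]; exact mem_range_self n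
  refine ⟨C, fun n => ⟨TopologicalSpace.isOpen_of_mem_countableBasis (hCb n),
    TopologicalSpace.nonempty_of_mem_countableBasis (hCb n)⟩, fun D hD => ?_⟩
  obtain ⟨y, hy⟩ := hD.2
  obtain ⟨V, hV, -, hVD⟩ := hb.exists_subset_of_mem_open hy hD.1
  obtain ⟨n, rfl⟩ : V ∈ range C := hC ▸ hV
  exact ⟨n, hVD⟩

theorem chargingMeasures_nonemptyOpens (Ω : Type*) [TopologicalSpace Ω] [MeasurableSpace Ω] :
    chargingMeasures (nonemptyOpens Ω) = fullSupportMeasures Ω := by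
  ext Q
  constructor
  · intro h
    refine eq_univ_of_forall fun x => ?_
    rw [Measure.mem_support_iff_forall]
    intro U hU
    obtain ⟨V, hVU, hV, hx⟩ := mem_nhds_iff.1 hU
    exact (h V ⟨hV, x, hx⟩).trans_le (measure_mono hVU)
  · rintro (h : (Q : Measure Ω).support = univ) C ⟨hC, x, hx⟩
    exact (Measure.mem_support_iff_forall x).1 (h.symm ▸ mem_univ x) C (hC.mem_nhds hx)

end ArbitrageClass

end

theorem mainTheorem7 {Ω : Type*} [TopologicalSpace Ω] [PolishSpace Ω] [Nonempty Ω]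
    [MeasurableSpace Ω] [BorelSpace Ω] {d T : ℕ} (hd : 1 ≤ d) (hT : 1 ≤ T)
    (𝓜 : ArbitrageClass.Market Ω d T)
    (v : Set (ArbitrageClass.Prices d) → ℕ → ArbitrageClass.Prices d)
    (hv : ArbitrageClass.IsSeparatorEnumeration v) :
    (∀ 𝒮 : Set (Set Ω), (∀ C ∈ 𝒮, MeasurableSet C) → ∅ ∉ 𝒮 →
      ArbitrageClass.HasCountableCore 𝒮 →
      (𝓜.NoArbitrage v 𝒮 ↔
        (𝓜.martingaleMeasures ∩ ArbitrageClass.chargingMeasures 𝒮).Nonempty)) ∧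
    ArbitrageClass.HasCountableCore (ArbitrageClass.nonemptyOpens Ω) ∧
    (𝓜.NoArbitrage v (ArbitrageClass.nonemptyOpens Ω) ↔
      (𝓜.martingaleMeasures ∩ ArbitrageClass.fullSupportMeasures Ω).Nonempty) := by
  refine ⟨fun 𝒮 _ _ h𝒮 => ArbitrageClass.Market.noArbitrage_iff hv h𝒮,
    ArbitrageClass.hasCountableCore_nonemptyOpens Ω, ?_⟩
  rw [← ArbitrageClass.chargingMeasures_nonemptyOpens]
  exact ArbitrageClass.Market.noArbitrage_iff hv (ArbitrageClass.hasCountableCore_nonemptyOpens Ω)
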